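/- Let $\nu\ge 1$, $a<b$, $\Omega=[a,b]^\nu\subset\mathbb R^\nu$ with Lebesgue measure $\mu$; integrals without limits are over $\Omega$. Let $k:\Omega^3\to\mathbb C$ be continuous, and let $T_1$ be the partial integral operator on $L_2(\Omega\times\Omega)$ (complex-valued functions), $$(T_1f)(x,y)=\int k(x,s,y)f(s,y)\,ds .$$ For $\varkappa\in\mathbb C$ let $D_1(y;\varkappa)$ and $M_1(x,s,y;\varkappa)$ be the Fredholm determinant and the Fredholm minor of the integral operator $E-\varkappa K_y$ on $L_2(\Omega)$, where $E$ is the identity and $K_y$ has the kernel $k(\cdot,\cdot,y)$, that is, $$D_1(y;\varkappa)=\sum_{n=0}^\infty\frac{(-\varkappa)^n}{n!}\int_{\Omega^n}\det\bigl[k(t_i,t_j,y)\bigr]_{i,j=1}^n\,dt_1\cdots dt_n,$$ $$M_1(x,s,y;\varkappa)=\sum_{n=0}^\infty\frac{(-\varkappa)^n}{n!}\int_{\Omega^n}\det\bigl[k(u_i,v_j,y)\bigr]_{i,j=0}^n\,dt_1\cdots dt_n,$$ where $u_0=x$, $v_0=s$ and $u_i=v_i=t_i$ for $1\le i\le n$.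 Let $\varkappa_0\in\mathbb C$ be an essential number, i.e. $D_1(y_0;\varkappa_0)=0$ for some $y_0\in\Omega$, but there is no measurable set $\Omega_0\subset\Omega$ with $\mu(\Omega_0)>0$ on which $D_1(\cdot;\varkappa_0)$ vanishes identically. Let $g_0\in L_2(\Omega\times\Omega)$ satisfy $$\int\frac{\int|g_0(s,y)|^2\,ds}{|D_1(y;\varkappa_0)|^2}\,dy<\infty .$$ Then the integral $$(Bg_0)(x,y)=\int\frac{M_1(x,s,y;\varkappa_0)}{D_1(y;\varkappa_0)}\,g_0(s,y)\,ds$$ converges absolutely for almost every $(x,y)$, the function $f=g_0+\varkappa_0Bg_0$ belongs to $L_2(\Omega\times\Omega)$, and $f$ is the unique solution in $L_2(\Omega\times\Omega)$ of the equation $f-\varkappa_0T_1f=g_0$. Moreover, the homogeneous equation $f-\varkappa_0T_1f=0$ has in $L_2(\Omega\times\Omega)$ only the trivial solution $f=0$. -/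

import Mathlib

open MeasureTheory
open scoped Nat ENNReal

noncomputable section

namespace PIE

/-- The cube `Ω = [a,b]^ν` as a (compact) space. It carries the subspace topology and
the induced Borel structure. -/
abbrev Cube (ν : ℕ) (a b : ℝ) : Type :=
  Set.Icc (fun _ : Fin ν => a) (fun _ : Fin ν => b)

/-- Lebesgue measure `μ` on `Ω`. -/
instance cubeMeasureSpace (ν : ℕ) (a b : ℝ) : MeasureSpace (Cube ν a b) where
  volume := Measure.comap Subtype.val (volume : Measure (Fin ν → ℝ))

/-- The Hilbert space `L₂(Ω × Ω)` of complex valued functions. -/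
abbrev H (ν : ℕ) (a b : ℝ) : Type :=
  Lp ℂ 2 (volume : Measure (Cube ν a b × Cube ν a b))

/-- Continuous kernels `k(x,s,y)` on `Ω³`. -/
abbrev Kernel (ν : ℕ) (a b : ℝ) : Type :=
  C(Cube ν a b × Cube ν a b × Cube ν a b, ℂ)

variable {ν : ℕ} {a b : ℝ}

/-- The partial integral operator `(T₁ f)(x,y) = ∫ k(x,s,y) f(s,y) ds`. -/
def T (k : Kernel ν a b) (f : Cube ν a b × Cube ν a b → ℂ) (p : Cube ν a b × Cube ν a b) : ℂ :=
  ∫ s : Cube ν a b, k (p.1, s, p.2) * f (s, p.2)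

/-- `f ∈ L₂(Ω × Ω)` solves `f - ϰ T₁ f = g` (equality of classes, i.e. almost everywhere). For
`f ∈ L₂(Ω × Ω)` almost every slice `f(·,y)` is square integrable on `Ω`, so that the integral
in `T₁ f` converges absolutely for almost all `(x,y)`. -/
def IsSolution (k : Kernel ν a b) (ϰ : ℂ) (g f : H ν a b) : Prop :=
  ∀ᵐ p : Cube ν a b × Cube ν a b, f p - ϰ * T k f p = g p

/-- The determinant `D₁(y;ϰ)` of `E - ϰ T₁`: the Fredholm determinant
`∑ₙ (-ϰ)ⁿ/n! ∫_{Ωⁿ} det [k(tᵢ,tⱼ,y)] dt₁ ⋯ dtₙ` of `E - ϰ K_y`, where `K_y` is the integral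
operator on `L₂(Ω)` with kernel `k(·,·,y)`. The series converges absolutely for every `ϰ`
(Hadamard's inequality). -/
def D (k : Kernel ν a b) (ϰ : ℂ) (y : Cube ν a b) : ℂ :=
  ∑' n : ℕ, (-ϰ) ^ n / (n ! : ℂ) *
    ∫ t : Fin n → Cube ν a b,
      Matrix.det (Matrix.of fun i j : Fin n => k (t i, t j, y))

/-- The minor `M₁(x,s,y;ϰ)` of `E - ϰ T₁`: the Fredholm minor
`∑ₙ (-ϰ)ⁿ/n! ∫_{Ωⁿ} det [k(uᵢ,vⱼ,y)] dt₁ ⋯ dtₙ` of `E - ϰ K_y`, with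
`u = (x,t₁,…,tₙ)` and `v = (s,t₁,…,tₙ)`; its term for `n = 0` is `k(x,s,y)`. -/
def M (k : Kernel ν a b) (ϰ : ℂ) (x s y : Cube ν a b) : ℂ :=
  ∑' n : ℕ, (-ϰ) ^ n / (n ! : ℂ) *
    ∫ t : Fin n → Cube ν a b,
      Matrix.det (Matrix.of fun i j : Fin (n + 1) =>
        k ((Fin.cons x t : Fin (n + 1) → Cube ν a b) i,
          (Fin.cons s t : Fin (n + 1) → Cube ν a b) j, y))

/-- The operator `(B g)(x,y) = ∫ (M₁(x,s,y;ϰ) / D₁(y;ϰ)) g(s,y) ds`. -/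
def B (k : Kernel ν a b) (ϰ : ℂ) (g : Cube ν a b × Cube ν a b → ℂ)
    (p : Cube ν a b × Cube ν a b) : ℂ :=
  ∫ s : Cube ν a b, M k ϰ p.1 s p.2 / D k ϰ p.2 * g (s, p.2)

/-- Singular numbers: `D₁(·;ϰ)` vanishes somewhere on `Ω`. -/
def singularNumbers (k : Kernel ν a b) : Set ℂ :=
  {ϰ | ∃ y₀ : Cube ν a b, D k ϰ y₀ = 0}

/-- Characteristic numbers: `D₁(·;ϰ)` vanishes on a measurable set of positive measure. -/
def characteristicNumbers (k : Kernel ν a b) : Set ℂ :=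
  {ϰ | ∃ Ω₀ : Set (Cube ν a b), MeasurableSet Ω₀ ∧ 0 < volume Ω₀ ∧ ∀ y ∈ Ω₀, D k ϰ y = 0}

/-- Essential numbers: singular but not characteristic. -/
def essentialNumbers (k : Kernel ν a b) : Set ℂ :=
  singularNumbers k \ characteristicNumbers k

end PIE

end

/-! The variable `y` is only a parameter of `T`: on the slice `f(·,y)` the operator acts as `K_y`,
so the equation splits into one Fredholm equation for each `y`. Since `ϰ₀` is not characteristic,
the measurable zero set of `D` is null, and almost every slice equation has nonvanishing
determinant.

On such a slice Fredholm's two relations, `M = k D + ϰ ∫ k M` and `M = k D + ϰ ∫ M k`, say that `M /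
D` is the resolvent kernel. Hence `u - ϰ K_y u = g` holds if and only if `u = g + ϰ ∫ (M / D) g`,
for `u` and `g` merely integrable (`Fredholm.solution_iff`). The relations come from expanding
bordered determinants along the first row and integrating termwise (`Fredholm.minorCoeff_succ`),
with convergence supplied by Hadamard's inequality.

Fubini reassembles the slices into `PIE.isSolution_iff`: solving the equation means being given
almost everywhere by the explicit formula, which yields uniqueness at once. Existence only requires
the formula to be in L₂. Since `M` is bounded, Cauchy–Schwarz reduces this to the weighted condition
on `g₀` (`PIE.memLp_B`). -/

noncomputable section

/-! ### Hadamard's bound, majorant series and bordered determinants -/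

open InnerProductSpace in
/-- Hadamard's inequality, in terms of a common bound for the entries. -/
theorem Matrix.norm_det_le_of_norm_entry_le {n : ℕ} {C : ℝ} (A : Matrix (Fin n) (Fin n) ℂ)
    (hA : ∀ i j, ‖A i j‖ ≤ C) : ‖A.det‖ ≤ (√n * C) ^ n := by
  rcases Nat.eq_zero_or_pos n with rfl | hn
  · simp
  have hC : 0 ≤ C := (norm_nonneg _).trans (hA ⟨0, hn⟩ ⟨0, hn⟩)
  let f : Fin n → EuclideanSpace ℂ (Fin n) := fun j => WithLp.toLp 2 fun i => A i j
  let b := EuclideanSpace.basisFun (Fin n) ℂ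
  have hf : ∀ j, ‖f j‖ ≤ √n * C := fun j => by
    rw [EuclideanSpace.norm_eq]
    refine (Real.sqrt_le_sqrt (Finset.sum_le_sum fun i _ =>
      pow_le_pow_left₀ (norm_nonneg _) (hA i j) 2)).trans ?_
    simp [Real.sqrt_mul, Real.sqrt_sq hC]
  have hfr : Module.finrank ℂ (EuclideanSpace ℂ (Fin n)) = Fintype.card (Fin n) := by simp
  let e := gramSchmidtOrthonormalBasis hfr f
  have hdet : A.det = b.toBasis.det f := by
    rw [Module.Basis.det_apply]
    congr 1
  -- The change between orthonormal bases has determinant of modulus 1. In the Gram–Schmidt basis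
  -- the columns of `A` become triangular, so only the diagonal inner products remain.
  have hmul : b.toBasis.det f = b.toBasis.det e * e.toBasis.det f := by
    have := b.toBasis.toMatrix_mul_toMatrix e.toBasis f
    rw [Module.Basis.det_apply, ← this, Matrix.det_mul]
    simp [Module.Basis.det_apply]
  rw [hdet, hmul, norm_mul, b.det_to_matrix_orthonormalBasis e, one_mul,
    gramSchmidtOrthonormalBasis_det, norm_prod]
  calc ∏ i, ‖inner ℂ (gramSchmidtOrthonormalBasis hfr f i) (f i)‖
      ≤ ∏ _i : Fin n, √n * C := Finset.prod_le_prod (fun _ _ => norm_nonneg _) fun i _ => by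
        refine (norm_inner_le_norm _ _).trans ?_
        rw [OrthonormalBasis.norm_eq_one, one_mul]
        exact hf i
    _ = _ := by simp

/-- Split off `(1/2)^n` and use `2uv ≤ u² + v²`: one square is geometric, and `n^n / n! ≤ e^n`
bounds the other by a term of an exponential series. -/
theorem Real.summable_sqrt_mul_pow_div_factorial (C : ℝ) :
    Summable fun n : ℕ => (√n * C) ^ n / n ! := by
  have h1 : Summable fun n : ℕ => ((1 / 4 : ℝ) ^ n + (4 * C ^ 2 * Real.exp 1) ^ n / n !) / 2 :=
    ((summable_geometric_of_lt_one (by norm_num) (by norm_num)).add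
      (Real.summable_pow_div_factorial _)).div_const 2
  refine Summable.of_norm_bounded h1 fun n => ?_
  have hpow : ((1 / 2 : ℝ) ^ n) ^ 2 = (1 / 4) ^ n := by rw [← pow_mul, mul_comm, pow_mul]; norm_num
  have hn : (n : ℝ) ^ n / n ! ≤ Real.exp 1 ^ n := by
    rw [← Real.exp_nat_mul, mul_one]
    exact Real.pow_div_factorial_le_exp _ (Nat.cast_nonneg n) n
  have hfac : (0 : ℝ) < n ! := by positivity
  have hv : ((√n * (2 * C)) ^ n / n !) ^ 2 ≤ (4 * C ^ 2 * Real.exp 1) ^ n / n ! := by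
    calc ((√n * (2 * C)) ^ n / n !) ^ 2 = (4 * C ^ 2) ^ n * ((n : ℝ) ^ n / n !) / n ! := by
          rw [div_pow, ← pow_mul, mul_comm n 2, pow_mul, mul_pow (√n),
            Real.sq_sqrt (Nat.cast_nonneg n)]
          rw [mul_pow, mul_pow 2 C]
          field_simp
          ring
      _ ≤ (4 * C ^ 2) ^ n * (Real.exp 1 ^ n) / n ! := (by gcongr)
      _ = (4 * C ^ 2 * Real.exp 1) ^ n / n ! := by rw [mul_pow _ (Real.exp 1)]
  have huv : ‖(√n * C) ^ n / (n ! : ℝ)‖ = (1 / 2) ^ n * |(√n * (2 * C)) ^ n / (n ! : ℝ)| := by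
    rw [Real.norm_eq_abs, ← abs_of_nonneg (show (0 : ℝ) ≤ (1 / 2) ^ n by positivity), ← abs_mul]
    congr 1
    rw [← mul_div_assoc, ← mul_pow]
    congr 2
    ring
  rw [huv]
  have := two_mul_le_add_sq ((1 / 2 : ℝ) ^ n) |(√n * (2 * C)) ^ n / (n ! : ℝ)|
  rw [sq_abs, hpow] at this
  linarith

/-- The surplus factor `n + 1`, due to dividing by `n!` instead of `(n+1)!`, is absorbed by doubling
`C`. -/
theorem Real.summable_sqrt_succ_mul_pow_div_factorial {C : ℝ} (hC : 0 ≤ C) :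
    Summable fun n : ℕ => (√(n + 1 : ℕ) * C) ^ (n + 1) / n ! := by
  refine Summable.of_nonneg_of_le (fun n => by positivity) (fun n => ?_)
    ((summable_nat_add_iff 1).2 (Real.summable_sqrt_mul_pow_div_factorial (2 * C)))
  have h2 : ((n + 1 : ℕ) : ℝ) ≤ 2 ^ (n + 1) := by exact_mod_cast Nat.lt_two_pow_self.le
  rw [mul_left_comm, mul_pow 2, Nat.factorial_succ, Nat.cast_mul, mul_div_mul_comm]
  refine le_mul_of_one_le_left (by positivity) ?_
  rwa [one_le_div (by positivity)]

/-- Expansion of a bordered determinant along its first row. -/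
theorem Matrix.det_bordered {R X : Type*} [CommRing R] (κ : X → X → R) {n : ℕ} (x s : X)
    (t : Fin (n + 1) → X) :
    (Matrix.of fun i j : Fin (n + 2) => κ ((Fin.cons x t : Fin (n + 2) → X) i)
        ((Fin.cons s t : Fin (n + 2) → X) j)).det =
      κ x s * (Matrix.of fun i j => κ (t i) (t j)).det -
      ∑ i, κ x (t i) * (Matrix.of fun a b : Fin (n + 1) =>
        κ ((Fin.cons (t i) (i.removeNth t) : Fin (n + 1) → X) a)
          ((Fin.cons s (i.removeNth t) : Fin (n + 1) → X) b)).det := by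
  rw [Matrix.det_succ_row_zero, Fin.sum_univ_succ, sub_eq_add_neg, ← Finset.sum_neg_distrib]
  congr 1
  · simp [Matrix.submatrix]
  refine Finset.sum_congr rfl fun i _ => ?_
  -- Moving the row of `t i` to the top is a cycle of sign `(-1)^i`. Against the cofactor sign
  -- `(-1)^(i+1)` it leaves `-1` for every `i`.
  have h : (Matrix.of fun i j : Fin (n + 2) => κ ((Fin.cons x t : Fin (n + 2) → X) i)
        ((Fin.cons s t : Fin (n + 2) → X) j)).submatrix Fin.succ i.succ.succAbove =
      (Matrix.of fun a b : Fin (n + 1) =>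
        κ ((Fin.cons (t i) (i.removeNth t) : Fin (n + 1) → X) a)
          ((Fin.cons s (i.removeNth t) : Fin (n + 1) → X) b)).submatrix i.cycleRange id := by
    ext a b
    simp only [Matrix.submatrix_apply, Matrix.of_apply, Fin.cons_succ, id]
    congr 1
    · rw [Fin.cons_apply_cycleRange, Fin.insertNth_self_removeNth]
    · refine Fin.cases ?_ (fun b => ?_) b
      · simp
      · simp [Fin.removeNth]
  rw [h, Matrix.det_permute, Fin.sign_cycleRange]
  simp only [Matrix.of_apply, Fin.cons_zero, Fin.cons_succ, Fin.val_succ, Units.val_pow_eq_pow_val,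
    Units.val_neg, Units.val_one, Int.cast_pow, Int.cast_neg, Int.cast_one, pow_succ]
  have h1 : ((-1 : R) ^ (i : ℕ)) * (-1) ^ (i : ℕ) = 1 := by
    rw [← mul_pow]; simp
  linear_combination (-κ x (t i) * Matrix.det (Matrix.of fun a b : Fin (n + 1) =>
        κ ((Fin.cons (t i) (i.removeNth t) : Fin (n + 1) → X) a)
          ((Fin.cons s (i.removeNth t) : Fin (n + 1) → X) b))) * h1
end

/-! ### Fredholm theory for a continuous kernel with a parameter -/

noncomputable section

namespace Fredholm

set_option linter.unusedSectionVars false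

variable {X : Type*} [TopologicalSpace X] [CompactSpace X] [SecondCountableTopology X]
  [MeasureSpace X] [BorelSpace X] [IsFiniteMeasure (volume : Measure X)]

/-- The integrated principal minors of order `n` of a kernel depending on a parameter `y`. -/
def detCoeff (K : C(X × X × X, ℂ)) (n : ℕ) (y : X) : ℂ :=
  ∫ t : Fin n → X, Matrix.det (Matrix.of fun i j : Fin n => K (t i, t j, y))

/-- The integrated bordered minors of order `n + 1` of a kernel depending on a parameter `y`. -/
def minorCoeff (K : C(X × X × X, ℂ)) (n : ℕ) (x s y : X) : ℂ :=
  ∫ t : Fin n → X, Matrix.det (Matrix.of fun i j : Fin (n + 1) =>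
    K ((Fin.cons x t : Fin (n + 1) → X) i, (Fin.cons s t : Fin (n + 1) → X) j, y))

/-- The Fredholm determinant. -/
def fredholmDet (K : C(X × X × X, ℂ)) (z : ℂ) (y : X) : ℂ :=
  ∑' n : ℕ, (-z) ^ n / (n ! : ℂ) * detCoeff K n y

/-- The Fredholm minor. -/
def fredholmMinor (K : C(X × X × X, ℂ)) (z : ℂ) (x s y : X) : ℂ :=
  ∑' n : ℕ, (-z) ^ n / (n ! : ℂ) * minorCoeff K n x s y

variable (K : C(X × X × X, ℂ))

theorem volume_real_pi_univ (n : ℕ) :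
    (volume : Measure (Fin n → X)).real Set.univ = (volume : Measure X).real Set.univ ^ n := by
  simp [measureReal_def, volume_pi, Measure.pi_univ]

theorem norm_detCoeff_le (n : ℕ) (y : X) :
    ‖detCoeff K n y‖ ≤ (√n * (‖K‖ * (volume : Measure X).real Set.univ)) ^ n := by
  have := norm_integral_le_of_norm_le_const (μ := (volume : Measure (Fin n → X)))
    (f := fun t => Matrix.det (Matrix.of fun i j : Fin n => K (t i, t j, y)))
    (Filter.Eventually.of_forall fun t =>
      Matrix.norm_det_le_of_norm_entry_le _ fun i j => K.norm_coe_le_norm _)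
  rwa [volume_real_pi_univ, ← mul_pow, mul_assoc] at this

/-- There are `n` integrations but a determinant of size `n + 1`. Replacing the total mass by `1 +`
itself makes the base at least 1, so the exponent can be raised to `n + 1`. -/
theorem norm_minorCoeff_le (n : ℕ) (x s y : X) :
    ‖minorCoeff K n x s y‖ ≤
      (√(n + 1 : ℕ) * (‖K‖ * (1 + (volume : Measure X).real Set.univ))) ^ (n + 1) := by
  have := norm_integral_le_of_norm_le_const (μ := (volume : Measure (Fin n → X)))
    (f := fun t => Matrix.det (Matrix.of fun i j : Fin (n + 1) =>
      K ((Fin.cons x t : Fin (n + 1) → X) i, (Fin.cons s t : Fin (n + 1) → X) j, y)))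
    (Filter.Eventually.of_forall fun t =>
      Matrix.norm_det_le_of_norm_entry_le _ fun i j => K.norm_coe_le_norm _)
  rw [volume_real_pi_univ] at this
  refine this.trans ?_
  rw [← mul_assoc (√_), mul_pow _ (1 + _)]
  refine mul_le_mul_of_nonneg_left ?_ (by positivity)
  have hV : (0 : ℝ) ≤ (volume : Measure X).real Set.univ := measureReal_nonneg
  exact (pow_le_pow_left₀ hV (by linarith) n).trans
    (pow_le_pow_right₀ (by linarith) n.le_succ)

theorem continuous_detCoeff (n : ℕ) : Continuous (detCoeff K n) := by
  have hc : Continuous fun p : X × (Fin n → X) =>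
      Matrix.det (Matrix.of fun i j : Fin n => K (p.2 i, p.2 j, p.1)) :=
    Continuous.matrix_det (by fun_prop)
  refine continuous_of_dominated (bound := fun _ => (√n * ‖K‖) ^ n)
    (fun y => (hc.comp (Continuous.prodMk_right y)).aestronglyMeasurable)
    (fun y => Filter.Eventually.of_forall fun t =>
      Matrix.norm_det_le_of_norm_entry_le _ fun i j => K.norm_coe_le_norm _)
    (integrable_const _)
    (Filter.Eventually.of_forall fun t => hc.comp (Continuous.prodMk_left t))

theorem continuous_bordered (n : ℕ) : Continuous fun p : (X × X × X) × (Fin n → X) =>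
    Matrix.det (Matrix.of fun i j : Fin (n + 1) =>
      K ((Fin.cons p.1.1 p.2 : Fin (n + 1) → X) i,
        (Fin.cons p.1.2.1 p.2 : Fin (n + 1) → X) j, p.1.2.2)) := by
  have h : ∀ (g : (X × X × X) × (Fin n → X) → X) (_ : Continuous g) (i : Fin (n + 1)),
      Continuous fun p : (X × X × X) × (Fin n → X) =>
        (Fin.cons (g p) p.2 : Fin (n + 1) → X) i := by
    intro g hg i
    refine Fin.cases ?_ (fun i => ?_) i
    · simpa using hg
    · simp only [Fin.cons_succ]; fun_prop
  refine Continuous.matrix_det (continuous_pi fun i => continuous_pi fun j => ?_)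
  have h1 := h (fun p => p.1.1) (by fun_prop) i
  have h2 := h (fun p => p.1.2.1) (by fun_prop) j
  exact K.continuous.comp (h1.prodMk (h2.prodMk (by fun_prop)))

theorem continuous_minorCoeff (n : ℕ) :
    Continuous fun p : X × X × X => minorCoeff K n p.1 p.2.1 p.2.2 := by
  have hc := continuous_bordered K n
  refine continuous_of_dominated (bound := fun _ => (√(n + 1 : ℕ) * ‖K‖) ^ (n + 1))
    (fun y => (hc.comp (Continuous.prodMk_right y)).aestronglyMeasurable)
    (fun y => Filter.Eventually.of_forall fun t =>
      Matrix.norm_det_le_of_norm_entry_le _ fun i j => K.norm_coe_le_norm _)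
    (integrable_const _)
    (Filter.Eventually.of_forall fun t => hc.comp (Continuous.prodMk_left t))

theorem norm_detTerm_le (z : ℂ) (n : ℕ) (y : X) :
    ‖(-z) ^ n / (n ! : ℂ) * detCoeff K n y‖ ≤
      (√n * (‖z‖ * (‖K‖ * (volume : Measure X).real Set.univ))) ^ n / n ! := by
  rw [norm_mul, norm_div, norm_pow, norm_neg, Complex.norm_natCast, div_mul_eq_mul_div,
    mul_left_comm, mul_pow ‖z‖]
  gcongr
  exact norm_detCoeff_le K n y

theorem norm_minorTerm_le (z : ℂ) (n : ℕ) (x s y : X) :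
    ‖(-z) ^ n / (n ! : ℂ) * minorCoeff K n x s y‖ ≤
      (√(n + 1 : ℕ) * ((1 + ‖z‖) * (‖K‖ * (1 + (volume : Measure X).real Set.univ)))) ^ (n + 1)
        / n ! := by
  rw [norm_mul, norm_div, norm_pow, norm_neg, Complex.norm_natCast, div_mul_eq_mul_div,
    mul_left_comm, mul_pow (1 + ‖z‖)]
  gcongr
  · exact (pow_le_pow_left₀ (norm_nonneg _) (by linarith) n).trans
      (pow_le_pow_right₀ (by linarith [norm_nonneg z]) n.le_succ)
  · exact norm_minorCoeff_le K n x s y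

theorem summable_minorBound (z : ℂ) : Summable fun n : ℕ =>
    (√(n + 1 : ℕ) * ((1 + ‖z‖) * (‖K‖ * (1 + (volume : Measure X).real Set.univ)))) ^ (n + 1)
      / n ! :=
  Real.summable_sqrt_succ_mul_pow_div_factorial (by positivity)

theorem summable_detTerm (z : ℂ) (y : X) :
    Summable fun n : ℕ => (-z) ^ n / (n ! : ℂ) * detCoeff K n y :=
  .of_norm_bounded (Real.summable_sqrt_mul_pow_div_factorial _) fun n => norm_detTerm_le K z n y

theorem summable_minorTerm (z : ℂ) (x s y : X) :
    Summable fun n : ℕ => (-z) ^ n / (n ! : ℂ) * minorCoeff K n x s y :=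
  .of_norm_bounded (summable_minorBound K z) fun n => norm_minorTerm_le K z n x s y

theorem continuous_fredholmDet (z : ℂ) : Continuous (fredholmDet K z) :=
  continuous_tsum (fun n => (continuous_detCoeff K n).const_mul _)
    (Real.summable_sqrt_mul_pow_div_factorial _) fun n y => norm_detTerm_le K z n y

theorem continuous_fredholmMinor (z : ℂ) :
    Continuous fun p : X × X × X => fredholmMinor K z p.1 p.2.1 p.2.2 :=
  continuous_tsum (fun n => (continuous_minorCoeff K n).const_mul _)
    (summable_minorBound K z) fun n p => norm_minorTerm_le K z n p.1 p.2.1 p.2.2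

theorem integrable_of_continuous {Y : Type*} [TopologicalSpace Y] [CompactSpace Y]
    [SecondCountableTopology Y] [MeasurableSpace Y] [OpensMeasurableSpace Y] {μ : Measure Y}
    [IsFiniteMeasure μ] {f : Y → ℂ} (hf : Continuous f) : Integrable f μ :=
  .of_bound hf.aestronglyMeasurable ‖(⟨f, hf⟩ : C(Y, ℂ))‖
    (Filter.Eventually.of_forall fun y => (⟨f, hf⟩ : C(Y, ℂ)).norm_coe_le_norm y)

theorem integral_removeNth (n : ℕ) (i : Fin (n + 1)) {F : X → (Fin n → X) → ℂ}
    (hF : Continuous fun p : X × (Fin n → X) => F p.1 p.2) :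
    ∫ t : Fin (n + 1) → X, F (t i) (i.removeNth t) = ∫ r, ∫ t, F r t := by
  have h := (volume_preserving_piFinSuccAbove (fun _ : Fin (n + 1) => X) i).integral_comp
    (MeasurableEquiv.measurableEmbedding _) (fun p => F p.1 p.2)
  rw [Measure.volume_eq_prod, integral_prod _ (integrable_of_continuous hF)] at h
  exact h

/-- Integrate `Matrix.det_bordered`. Renaming `t i` as `r`, Fubini gives all `n + 1` summands of the
expansion the same integral. -/
theorem minorCoeff_succ (n : ℕ) (x s y : X) :
    minorCoeff K (n + 1) x s y = K (x, s, y) * detCoeff K (n + 1) y -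
      (n + 1) * ∫ r, K (x, r, y) * minorCoeff K n r s y := by
  have hb : Continuous fun p : X × (Fin n → X) => K (x, p.1, y) *
      (Matrix.of fun a b : Fin (n + 1) => K ((Fin.cons p.1 p.2 : Fin (n + 1) → X) a,
          (Fin.cons s p.2 : Fin (n + 1) → X) b, y)).det :=
    (by fun_prop : Continuous fun p : X × (Fin n → X) => K (x, p.1, y)).mul
      ((continuous_bordered K n).comp (f := fun p : X × (Fin n → X) => ((p.1, s, y), p.2))
        (by fun_prop))
  have hi : ∀ i : Fin (n + 1), Continuous fun t : Fin (n + 1) → X => K (x, t i, y) *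
      (Matrix.of fun a b : Fin (n + 1) =>
        K ((Fin.cons (t i) (i.removeNth t) : Fin (n + 1) → X) a,
          (Fin.cons s (i.removeNth t) : Fin (n + 1) → X) b, y)).det := fun i =>
    hb.comp (f := fun t : Fin (n + 1) → X => (t i, i.removeNth t))
      ((continuous_apply i).prodMk (continuous_pi fun j => continuous_apply _))
  have hd : Continuous fun t : Fin (n + 1) → X =>
      K (x, s, y) * (Matrix.of fun i j : Fin (n + 1) => K (t i, t j, y)).det :=
    continuous_const.mul (Continuous.matrix_det (by fun_prop))
  unfold minorCoeff detCoeff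
  simp_rw [fun t => Matrix.det_bordered (fun u v => K (u, v, y)) x s (n := n) t]
  rw [integral_sub (integrable_of_continuous hd)
    (integrable_finsetSum _ fun i _ => integrable_of_continuous (hi i)),
    integral_finsetSum _ fun i _ => integrable_of_continuous (hi i), integral_const_mul]
  congr 1
  refine (Finset.sum_congr rfl fun i _ => integral_removeNth n i (F := fun r t =>
    K (x, r, y) * (Matrix.of fun a b : Fin (n + 1) => K ((Fin.cons r t : Fin (n + 1) → X) a,
      (Fin.cons s t : Fin (n + 1) → X) b, y)).det) hb).trans ?_
  simp [integral_const_mul]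

theorem detCoeff_zero (y : X) : detCoeff K 0 y = 1 := by
  simp [detCoeff, volume_real_pi_univ]

theorem minorCoeff_zero (x s y : X) : minorCoeff K 0 x s y = K (x, s, y) := by
  simp [minorCoeff, volume_real_pi_univ]

/-- Fredholm's first fundamental relation. -/
theorem fredholmMinor_eq (z : ℂ) (x s y : X) :
    fredholmMinor K z x s y = K (x, s, y) * fredholmDet K z y +
      z * ∫ r, K (x, r, y) * fredholmMinor K z r s y := by
  let F : ℕ → X → ℂ := fun n r => K (x, r, y) * ((-z) ^ n / (n ! : ℂ) * minorCoeff K n r s y)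
  have hF : ∀ n, Continuous (F n) := fun n =>
    (by fun_prop : Continuous fun r => K (x, r, y)).mul (continuous_const.mul
      ((continuous_minorCoeff K n).comp (f := fun r => (r, s, y)) (by fun_prop)))
  have hFi : ∀ n, Integrable (F n) := fun n => integrable_of_continuous (hF n)
  have hFs : Summable fun n => ∫ r, ‖F n r‖ := by
    refine Summable.of_nonneg_of_le (fun n => integral_nonneg fun r => norm_nonneg _) (fun n => ?_)
      (((summable_minorBound K z).mul_left ‖K‖).mul_right ((volume : Measure X).real Set.univ))
    refine (Real.le_norm_self _).trans ?_
    refine norm_integral_le_of_norm_le_const (Filter.Eventually.of_forall fun r => ?_)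
    rw [norm_norm, norm_mul]
    exact mul_le_mul (K.norm_coe_le_norm _) (norm_minorTerm_le K z n r s y) (norm_nonneg _)
      (norm_nonneg _)
  have hsum : HasSum (fun n => ∫ r, F n r) (∫ r, K (x, r, y) * fredholmMinor K z r s y) := by
    have := hasSum_integral_of_summable_integral_norm hFi hFs
    simpa only [F, tsum_mul_left, fredholmMinor] using this
  -- The recurrence multiplied by its coefficient: `(-z)^(n+1)/(n+1)! · (-(n+1)) = z · (-z)^n/n!`,
  -- so the index shift produces exactly the factor `z`.
  have hterm : ∀ n : ℕ, (-z) ^ (n + 1) / ((n + 1)! : ℂ) * minorCoeff K (n + 1) x s y =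
      K (x, s, y) * ((-z) ^ (n + 1) / ((n + 1)! : ℂ) * detCoeff K (n + 1) y) +
        z * ∫ r, F n r := by
    intro n
    have h1 : ∫ r, F n r =
        (-z) ^ n / (n ! : ℂ) * ∫ r, K (x, r, y) * minorCoeff K n r s y := by
      rw [← integral_const_mul]
      exact integral_congr_ae (Filter.Eventually.of_forall fun r => by simp only [F]; ring)
    have h2 : (n ! : ℂ) ≠ 0 := by exact_mod_cast n.factorial_ne_zero
    have h3 : (n + 1 : ℂ) ≠ 0 := by exact_mod_cast n.succ_ne_zero
    rw [h1, minorCoeff_succ, Nat.factorial_succ]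
    push_cast
    field_simp
    ring
  have hd := (summable_nat_add_iff 1).2 (summable_detTerm K z y)
  rw [fredholmMinor, (summable_minorTerm K z x s y).tsum_eq_zero_add, fredholmDet,
    (summable_detTerm K z y).tsum_eq_zero_add]
  simp_rw [hterm]
  rw [(hd.mul_left _).tsum_add (hsum.summable.mul_left _), tsum_mul_left, tsum_mul_left,
    hsum.tsum_eq]
  simp [minorCoeff_zero, detCoeff_zero]
  ring

/-- The kernel with its first two arguments exchanged. -/
def transposeKernel : C(X × X × X, ℂ) := ⟨fun p => K (p.2.1, p.1, p.2.2), by fun_prop⟩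

theorem fredholmDet_transposeKernel (z : ℂ) (y : X) :
    fredholmDet (transposeKernel K) z y = fredholmDet K z y := by
  unfold fredholmDet detCoeff
  congr! 5 with n t
  rw [← Matrix.det_transpose]
  rfl

theorem fredholmMinor_transposeKernel (z : ℂ) (x s y : X) :
    fredholmMinor (transposeKernel K) z x s y = fredholmMinor K z s x y := by
  unfold fredholmMinor minorCoeff
  congr! 5 with n t
  rw [← Matrix.det_transpose]
  rfl

/-- Fredholm's second fundamental relation. -/
theorem fredholmMinor_eq' (z : ℂ) (x s y : X) :
    fredholmMinor K z x s y = K (x, s, y) * fredholmDet K z y +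
      z * ∫ r, fredholmMinor K z x r y * K (r, s, y) := by
  have := fredholmMinor_eq (transposeKernel K) z s x y
  simp only [fredholmDet_transposeKernel, fredholmMinor_transposeKernel] at this
  rw [this]
  congr 2
  exact integral_congr_ae (Filter.Eventually.of_forall fun r => mul_comm _ _)

/-- If `R` is the resolvent kernel of `κ` and `u = g + z κ u`, then `κ u = R g`. -/
theorem integral_kernel_eq_integral_resolvent {κ R : X → X → ℂ} {z : ℂ}
    (hκ : Continuous fun p : X × X => κ p.1 p.2) (hR : Continuous fun p : X × X => R p.1 p.2)
    (h : ∀ x s, R x s = κ x s + z * ∫ r, R x r * κ r s) {u g : X → ℂ}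
    (hu : Integrable u) (hg : Integrable g) (hsol : ∀ᵐ x, u x = g x + z * ∫ s, κ x s * u s)
    (x : X) : ∫ s, κ x s * u s = ∫ s, R x s * g s := by
  have bdd : ∀ {f : X → ℂ}, Continuous f → ∀ {v : X → ℂ}, Integrable v →
      Integrable fun s => f s * v s := fun {f} hf {v} hv =>
    hv.bdd_mul (c := ‖(⟨f, hf⟩ : C(X, ℂ))‖) hf.aestronglyMeasurable
      (Filter.Eventually.of_forall fun s => (⟨f, hf⟩ : C(X, ℂ)).norm_coe_le_norm s)
  have hκx : Continuous (κ x) := hκ.comp (Continuous.prodMk_right x)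
  have hRx : Continuous (R x) := hR.comp (Continuous.prodMk_right x)
  have hprod : Integrable (fun p : X × X => R x p.1 * κ p.1 p.2 * u p.2)
      ((volume : Measure X).prod volume) := by
    have hc : Continuous fun p : X × X => R x p.1 * κ p.1 p.2 :=
      (hRx.comp continuous_fst).mul hκ
    exact (hu.comp_snd _).bdd_mul (c := ‖(⟨_, hc⟩ : C(X × X, ℂ))‖) hc.aestronglyMeasurable
      (Filter.Eventually.of_forall fun s => (⟨_, hc⟩ : C(X × X, ℂ)).norm_coe_le_norm s)
  have hi : ∫ r, R x r * ∫ s, κ r s * u s = ∫ s, (∫ r, R x r * κ r s) * u s := by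
    calc ∫ r, R x r * ∫ s, κ r s * u s = ∫ r, ∫ s, R x r * κ r s * u s := by
          simp_rw [mul_assoc, integral_const_mul]
      _ = ∫ s, ∫ r, R x r * κ r s * u s := integral_integral_swap hprod
      _ = _ := by simp_rw [integral_mul_const]
  have hinner : Integrable fun s => (∫ r, R x r * κ r s) * u s := by
    have := hprod.integral_prod_right
    simpa only [integral_mul_const] using this
  -- `∫ R u` is computed twice, from the resolvent equation (`e1`) and from the equation for `u`
  -- (`e2`). The double integral is common to both and cancels.
  have e1 : ∫ s, R x s * u s = (∫ s, κ x s * u s) + z * ∫ r, R x r * ∫ s, κ r s * u s := by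
    rw [hi, ← integral_const_mul, ← integral_add (bdd hκx hu)
     
      (hinner.const_mul z)]
    refine integral_congr_ae (Filter.Eventually.of_forall fun s => ?_)
    simp only [h x s]
    ring
  have houter : Integrable fun r => R x r * ∫ s, κ r s * u s := by
    have := hprod.integral_prod_left
    simpa only [mul_assoc, integral_const_mul] using this
  have e2 : ∫ s, R x s * u s = (∫ s, R x s * g s) + z * ∫ r, R x r * ∫ s, κ r s * u s := by
    rw [← integral_const_mul, ← integral_add (bdd hRx hg) (houter.const_mul z)]
    refine integral_congr_ae ?_
    filter_upwards [hsol] with s hs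
    rw [hs]
    ring
  exact add_right_cancel (e1.symm.trans e2)

/-- Away from the zeros of the Fredholm determinant, `u - z K_y u = g` is solved by the
resolvent kernel. -/
theorem solution_iff {z : ℂ} {y : X} (hD : fredholmDet K z y ≠ 0) {u g : X → ℂ}
    (hu : Integrable u) (hg : Integrable g) :
    (∀ᵐ x, u x - z * ∫ s, K (x, s, y) * u s = g x) ↔
      ∀ᵐ x, u x = g x + z * ∫ s, fredholmMinor K z x s y / fredholmDet K z y * g s := by
  have hκ : Continuous fun p : X × X => K (p.1, p.2, y) := by fun_prop
  have hR : Continuous fun p : X × X => fredholmMinor K z p.1 p.2 y / fredholmDet K z y :=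
    ((continuous_fredholmMinor K z).comp (f := fun p : X × X => (p.1, p.2, y))
      (by fun_prop)).div_const _
  have h1 : ∀ x s, fredholmMinor K z x s y / fredholmDet K z y = K (x, s, y) +
      z * ∫ r, fredholmMinor K z x r y / fredholmDet K z y * K (r, s, y) := fun x s => by
    simp_rw [div_mul_eq_mul_div, integral_div]
    rw [fredholmMinor_eq', add_div, mul_div_cancel_right₀ _ hD, mul_div_assoc]
  -- The relation is symmetric: `K` is in turn the resolvent kernel of `M / D` with parameter `-z`.
  -- The converse is therefore the same lemma with the roles of `u` and `g` exchanged.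
  have h2 : ∀ x s, K (x, s, y) = fredholmMinor K z x s y / fredholmDet K z y +
      -z * ∫ r, K (x, r, y) * (fredholmMinor K z r s y / fredholmDet K z y) := fun x s => by
    simp_rw [← mul_div_assoc, integral_div]
    rw [fredholmMinor_eq, add_div, mul_div_cancel_right₀ _ hD]
    ring
  constructor
  · intro h
    have h' : ∀ᵐ x, u x = g x + z * ∫ s, K (x, s, y) * u s := by
      filter_upwards [h] with x hx
      rw [← hx]; ring
    filter_upwards [h'] with x hx
    rw [hx]
    congr 2
    exact integral_kernel_eq_integral_resolvent hκ hR h1 hu hg h' x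
  · intro h
    have h' : ∀ᵐ x, g x = u x +
        -z * ∫ s, fredholmMinor K z x s y / fredholmDet K z y * g s := by
      filter_upwards [h] with x hx
      rw [hx]; ring
    filter_upwards [h'] with x hx
    rw [hx, ← integral_kernel_eq_integral_resolvent hR hκ h2 hg hu h' x]
    ring

end Fredholm
end

/-! ### The partial integral operator on L₂(Ω × Ω) -/

noncomputable section

namespace PIE

variable {ν : ℕ} {a b : ℝ}

instance : BorelSpace (Cube ν a b) := inferInstanceAs (BorelSpace (Set.Icc _ _))

instance : IsFiniteMeasure (volume : Measure (Cube ν a b)) := by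
  refine ⟨?_⟩
  change Measure.comap Subtype.val (volume : Measure (Fin ν → ℝ)) Set.univ < ∞
  rw [comap_subtype_coe_apply measurableSet_Icc, Set.image_univ, Subtype.range_coe]
  exact isCompact_Icc.measure_lt_top

theorem continuous_D (k : Kernel ν a b) (ϰ : ℂ) : Continuous (D k ϰ) :=
  Fredholm.continuous_fredholmDet k ϰ

theorem continuous_M (k : Kernel ν a b) (ϰ : ℂ) :
    Continuous fun p : Cube ν a b × Cube ν a b × Cube ν a b => M k ϰ p.1 p.2.1 p.2.2 :=
  Fredholm.continuous_fredholmMinor k ϰ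

theorem exists_norm_M_le (k : Kernel ν a b) (ϰ : ℂ) :
    ∃ C : ℝ, 0 ≤ C ∧ ∀ x s y, ‖M k ϰ x s y‖ ≤ C :=
  ⟨‖(⟨_, continuous_M k ϰ⟩ : C(Cube ν a b × Cube ν a b × Cube ν a b, ℂ))‖, norm_nonneg _,
    fun x s y => (⟨_, continuous_M k ϰ⟩ : C(_, ℂ)).norm_coe_le_norm (x, s, y)⟩

/-- By continuity of `D` its zero set is measurable, so with positive measure it would itself
witness that `ϰ` is characteristic. -/
theorem ae_D_ne_zero {k : Kernel ν a b} {ϰ : ℂ} (h : ϰ ∉ characteristicNumbers k) :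
    ∀ᵐ y, D k ϰ y ≠ 0 := by
  rw [ae_iff]
  by_contra h0
  refine h ⟨{y | ¬ D k ϰ y ≠ 0}, ?_, pos_iff_ne_zero.2 h0, fun y hy => not_not.1 hy⟩
  exact (measurableSet_eq_fun (continuous_D k ϰ).measurable measurable_const).compl.compl

theorem ae_prod_iff_ae_slice {α β : Type*} [MeasureSpace α] [MeasureSpace β]
    [SFinite (volume : Measure α)] [SFinite (volume : Measure β)] {p : α × β → Prop}
    (hp : MeasurableSet {z | p z}) :
    (∀ᵐ z : α × β, p z) ↔ ∀ᵐ y : β, ∀ᵐ x : α, p (x, y) := by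
  rw [Measure.volume_eq_prod, Measure.ae_prod_iff_ae_ae hp]
  exact Measure.ae_ae_comm hp

theorem ae_integrable_slice (g : H ν a b) : ∀ᵐ y, Integrable fun s => g (s, y) := by
  have hg : Integrable g ((volume : Measure (Cube ν a b)).prod volume) :=
    (Lp.memLp g).integrable one_le_two
  exact hg.prod_left_ae

theorem integrable_kernel_mul (k : Kernel ν a b) (ϰ : ℂ) (x y : Cube ν a b)
    {u : Cube ν a b → ℂ} (hu : Integrable u) :
    Integrable fun s => M k ϰ x s y / D k ϰ y * u s := by
  obtain ⟨C, -, hC⟩ := exists_norm_M_le k ϰ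
  refine hu.bdd_mul (c := C / ‖D k ϰ y‖) ?_ (Filter.Eventually.of_forall fun s => ?_)
  · exact (((continuous_M k ϰ).comp (f := fun s : Cube ν a b => (x, s, y))
      (by fun_prop)).div_const _).aestronglyMeasurable
  · rw [norm_div]
    gcongr
    exact hC x s y

theorem stronglyMeasurable_slice (g : H ν a b) :
    StronglyMeasurable fun q : (Cube ν a b × Cube ν a b) × Cube ν a b => g (q.2, q.1.2) :=
  (Lp.stronglyMeasurable g).comp_measurable (by fun_prop)

theorem stronglyMeasurable_T (k : Kernel ν a b) (g : H ν a b) : StronglyMeasurable (T k g) := by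
  have hk : Continuous fun q : (Cube ν a b × Cube ν a b) × Cube ν a b => k (q.1.1, q.2, q.1.2) := by
    fun_prop
  exact (hk.stronglyMeasurable.mul (stronglyMeasurable_slice g)).integral_prod_right'

theorem stronglyMeasurable_B (k : Kernel ν a b) (ϰ : ℂ) (g : H ν a b) :
    StronglyMeasurable (B k ϰ g) := by
  have hM : Continuous fun q : (Cube ν a b × Cube ν a b) × Cube ν a b =>
      M k ϰ q.1.1 q.2 q.1.2 :=
    (continuous_M k ϰ).comp (f := fun q : (Cube ν a b × Cube ν a b) × Cube ν a b =>
      (q.1.1, q.2, q.1.2)) (by fun_prop)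
  have hD : Continuous fun q : (Cube ν a b × Cube ν a b) × Cube ν a b => D k ϰ q.1.2 :=
    (continuous_D k ϰ).comp (by fun_prop)
  have hR : StronglyMeasurable fun q : (Cube ν a b × Cube ν a b) × Cube ν a b =>
      M k ϰ q.1.1 q.2 q.1.2 / D k ϰ q.1.2 :=
    (hM.measurable.div hD.measurable).stronglyMeasurable
  exact (hR.mul (stronglyMeasurable_slice g)).integral_prod_right'

theorem ae_integrable_B (k : Kernel ν a b) (ϰ : ℂ) (g : H ν a b) :
    ∀ᵐ p : Cube ν a b × Cube ν a b,
      Integrable fun s => M k ϰ p.1 s p.2 / D k ϰ p.2 * g (s, p.2) := by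
  filter_upwards [Measure.quasiMeasurePreserving_snd.ae (ae_integrable_slice g)] with p hp
  exact integrable_kernel_mul k ϰ p.1 p.2 hp

/-- For almost every `y` the determinant is nonzero and both slices are integrable, so
`Fredholm.solution_iff` applies. Measurability of `T k f` and `B k ϰ g` lets Fubini pass between the
slices and the product. -/
theorem isSolution_iff {k : Kernel ν a b} {ϰ : ℂ} (h : ϰ ∉ characteristicNumbers k)
    (g f : H ν a b) : IsSolution k ϰ g f ↔ ∀ᵐ p, f p = g p + ϰ * B k ϰ g p := by
  have hf := (Lp.stronglyMeasurable f).measurable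
  have hg := (Lp.stronglyMeasurable g).measurable
  have hT := (stronglyMeasurable_T k f).measurable
  have hB := (stronglyMeasurable_B k ϰ g).measurable
  unfold IsSolution
  rw [ae_prod_iff_ae_slice
      (p := fun p => f p - ϰ * T k f p = g p)
      (measurableSet_eq_fun (hf.sub (hT.const_mul ϰ)) hg),
    ae_prod_iff_ae_slice (p := fun p => f p = g p + ϰ * B k ϰ g p)
      (measurableSet_eq_fun hf (hg.add (hB.const_mul ϰ)))]
  have key : ∀ᵐ y, (∀ᵐ x, f (x, y) - ϰ * T k f (x, y) = g (x, y)) ↔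
      ∀ᵐ x, f (x, y) = g (x, y) + ϰ * B k ϰ g (x, y) := by
    filter_upwards [ae_D_ne_zero h, ae_integrable_slice f, ae_integrable_slice g] with y hD hfy hgy
    exact Fredholm.solution_iff k hD hfy hgy
  exact ⟨fun H => by filter_upwards [key, H] with y hy hH using hy.1 hH,
    fun H => by filter_upwards [key, H] with y hy hH using hy.2 hH⟩

/-- Cauchy–Schwarz against the constant 1. -/
theorem enorm_integral_sq_le {α : Type*} [MeasurableSpace α] {μ : Measure α} {u : α → ℂ}
    (hu : AEMeasurable u μ) :
    (∫⁻ s, ‖u s‖ₑ ∂μ) ^ 2 ≤ μ Set.univ * ∫⁻ s, ‖u s‖ₑ ^ 2 ∂μ := by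
  have h := ENNReal.lintegral_mul_le_Lp_mul_Lq μ Real.HolderConjugate.two_two
    (aemeasurable_const (b := (1 : ℝ≥0∞))) hu.enorm
  simp only [Pi.mul_apply, one_mul, ENNReal.one_rpow, lintegral_const] at h
  refine (pow_le_pow_left₀ (zero_le) h 2).trans_eq ?_
  rw [mul_pow, ← ENNReal.rpow_natCast, ← ENNReal.rpow_natCast, ← ENNReal.rpow_mul,
    ← ENNReal.rpow_mul]
  norm_num

/-- With `C` bounding `M`, `|B g(x,y)|² ≤ C² μ(Ω) ∫|g(s,y)|² ds / |D(y)|²` for almost every `y`. The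
right side does not depend on `x`, so integrating costs one more factor `μ(Ω)`. -/
theorem memLp_B (k : Kernel ν a b) {ϰ : ℂ} (g : H ν a b)
    (hg : ∫⁻ y : Cube ν a b, (∫⁻ s : Cube ν a b, ‖g (s, y)‖ₑ ^ 2) / ‖D k ϰ y‖ₑ ^ 2 < ∞)
    (h : ϰ ∉ characteristicNumbers k) : MemLp (B k ϰ g) 2 := by
  refine ⟨(stronglyMeasurable_B k ϰ g).aestronglyMeasurable, ?_⟩
  obtain ⟨C, hC0, hC⟩ := exists_norm_M_le k ϰ
  have hpt : ∀ p : Cube ν a b × Cube ν a b, D k ϰ p.2 ≠ 0 → ‖B k ϰ g p‖ₑ ^ 2 ≤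
      ENNReal.ofReal C ^ 2 * volume (Set.univ : Set (Cube ν a b)) *
        ((∫⁻ s : Cube ν a b, ‖g (s, p.2)‖ₑ ^ 2) / ‖D k ϰ p.2‖ₑ ^ 2) := by
    intro p hp
    have hm : AEMeasurable fun s => g (s, p.2) :=
      ((Lp.stronglyMeasurable g).measurable.comp (by fun_prop)).aemeasurable
    have h1 : ‖B k ϰ g p‖ₑ ≤
        ENNReal.ofReal C / ‖D k ϰ p.2‖ₑ * ∫⁻ s : Cube ν a b, ‖g (s, p.2)‖ₑ := by
      refine (enorm_integral_le_lintegral_enorm _).trans ?_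
      rw [← lintegral_const_mul'' _ hm.enorm]
      refine lintegral_mono fun s => ?_
      rw [enorm_mul, div_eq_mul_inv, enorm_mul, enorm_inv hp, ← div_eq_mul_inv]
      gcongr
      rw [← ofReal_norm]
      exact ENNReal.ofReal_le_ofReal (hC _ _ _)
    calc ‖B k ϰ g p‖ₑ ^ 2
        ≤ (ENNReal.ofReal C / ‖D k ϰ p.2‖ₑ * ∫⁻ s : Cube ν a b, ‖g (s, p.2)‖ₑ) ^ 2 := by gcongr
      _ ≤ (ENNReal.ofReal C / ‖D k ϰ p.2‖ₑ) ^ 2 * (volume (Set.univ : Set (Cube ν a b)) *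
          ∫⁻ s : Cube ν a b, ‖g (s, p.2)‖ₑ ^ 2) := by
        rw [mul_pow]
        gcongr
        exact enorm_integral_sq_le hm
      _ = _ := by
        simp only [div_eq_mul_inv, mul_pow, ENNReal.inv_pow]
        ring
  have hmeas : Measurable fun y : Cube ν a b =>
      (∫⁻ s : Cube ν a b, ‖g (s, y)‖ₑ ^ 2) / ‖D k ϰ y‖ₑ ^ 2 :=
    (Measurable.lintegral_prod_left' (f := fun q : Cube ν a b × Cube ν a b => ‖g q‖ₑ ^ 2)
      ((Lp.stronglyMeasurable g).measurable.enorm.pow_const 2)).div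
      ((continuous_D k ϰ).measurable.enorm.pow_const 2)
  have hV : volume (Set.univ : Set (Cube ν a b)) < ∞ := measure_lt_top _ _
  have hfin : ∫⁻ p : Cube ν a b × Cube ν a b, ‖B k ϰ g p‖ₑ ^ 2 < ∞ := by
    refine (lintegral_mono_ae (g := fun p => ENNReal.ofReal C ^ 2 *
      volume (Set.univ : Set (Cube ν a b)) *
        ((∫⁻ s : Cube ν a b, ‖g (s, p.2)‖ₑ ^ 2) / ‖D k ϰ p.2‖ₑ ^ 2)) ?_).trans_lt ?_
    · filter_upwards [Measure.quasiMeasurePreserving_snd.ae (ae_D_ne_zero h)] with p hp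
      exact hpt p hp
    · have hm : Measurable fun p : Cube ν a b × Cube ν a b =>
          (∫⁻ s : Cube ν a b, ‖g (s, p.2)‖ₑ ^ 2) / ‖D k ϰ p.2‖ₑ ^ 2 :=
        hmeas.comp measurable_snd
      have e := lintegral_prod (μ := (volume : Measure (Cube ν a b)))
        (ν := (volume : Measure (Cube ν a b))) _ hm.aemeasurable
      simp only [lintegral_const] at e
      refine (lintegral_const_mul _ hm).trans_lt ?_
      refine ENNReal.mul_lt_top (ENNReal.mul_lt_top (by finiteness) hV) (e.trans_lt ?_)
      exact ENNReal.mul_lt_top hg hV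
  rw [eLpNorm_lt_top_iff_lintegral_rpow_enorm_lt_top two_ne_zero ENNReal.ofNat_ne_top]
  simpa using hfin

/-- The chosen representative of the class 0 vanishes only almost everywhere, so Fubini is needed to
see that almost all its slices are null. -/
theorem B_zero_ae (k : Kernel ν a b) (ϰ : ℂ) : ∀ᵐ p, B k ϰ (0 : H ν a b) p = 0 := by
  have h0 : ∀ᵐ y, ∀ᵐ s, (0 : H ν a b) (s, y) = 0 :=
    (ae_prod_iff_ae_slice (measurableSet_eq_fun (Lp.stronglyMeasurable _).measurable
      measurable_const)).1 (Lp.coeFn_zero ℂ 2 _)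
  filter_upwards [Measure.quasiMeasurePreserving_snd.ae h0] with p hp
  refine integral_eq_zero_of_ae ?_
  filter_upwards [hp] with s hs
  rw [hs, mul_zero, Pi.zero_apply]

end PIE

end

/-! ### The main theorem -/

theorem theorem4 (ν : ℕ) (a b : ℝ) (hab : a < b) (k : PIE.Kernel ν a b) (ϰ₀ : ℂ)
    (hϰ₀ : ϰ₀ ∈ PIE.essentialNumbers k) (g₀ : PIE.H ν a b)
    (hg₀ : ∫⁻ y : PIE.Cube ν a b,
      (∫⁻ s : PIE.Cube ν a b, ‖g₀ (s, y)‖ₑ ^ 2) / ‖PIE.D k ϰ₀ y‖ₑ ^ 2 < ∞) :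
    (∀ᵐ p : PIE.Cube ν a b × PIE.Cube ν a b,
      Integrable fun s : PIE.Cube ν a b =>
        PIE.M k ϰ₀ p.1 s p.2 / PIE.D k ϰ₀ p.2 * g₀ (s, p.2)) ∧
    (∃ f : PIE.H ν a b,
      (∀ᵐ p : PIE.Cube ν a b × PIE.Cube ν a b, f p = g₀ p + ϰ₀ * PIE.B k ϰ₀ g₀ p) ∧
      ∀ f' : PIE.H ν a b, PIE.IsSolution k ϰ₀ g₀ f' ↔ f' = f) ∧
    (∀ h : PIE.H ν a b, PIE.IsSolution k ϰ₀ 0 h ↔ h = 0) := by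
  refine ⟨PIE.ae_integrable_B k ϰ₀ g₀, ?_, fun h => ?_⟩
  · have hmem : MemLp (fun p => g₀ p + ϰ₀ * PIE.B k ϰ₀ g₀ p) 2 :=
      (Lp.memLp g₀).add ((PIE.memLp_B k g₀ hg₀ hϰ₀.2).const_mul ϰ₀)
    refine ⟨hmem.toLp _, hmem.coeFn_toLp, fun f' => ?_⟩
    -- Being a solution and being equal to `f` both become almost everywhere equality with the
    -- explicit formula, which gives existence and uniqueness together.
    rw [PIE.isSolution_iff hϰ₀.2, Lp.ext_iff]
    exact ⟨fun H => Filter.EventuallyEq.trans H hmem.coeFn_toLp.symm,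
      fun H => Filter.EventuallyEq.trans H hmem.coeFn_toLp⟩
  · rw [PIE.isSolution_iff hϰ₀.2, Lp.ext_iff]
    have h0 : (fun p => (0 : PIE.H ν a b) p + ϰ₀ * PIE.B k ϰ₀ (0 : PIE.H ν a b) p) =ᵐ[volume]
        (0 : PIE.H ν a b) := by
      filter_upwards [PIE.B_zero_ae k ϰ₀] with p hp
      rw [hp, mul_zero, add_zero]
    exact ⟨fun H => Filter.EventuallyEq.trans H h0, fun H => Filter.EventuallyEq.trans H h0.symm⟩
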